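/- Let $\mathbb F$ be $\mathbb R$ or $\mathbb C$. For a Banach space $E$ over $\mathbb F$ with dual $E'$, a bounded set $B\subseteq E$ is called limited if $\lim_{n}\sup_{x\in B}|\chi_n(x)|=0$ for every weak$^*$ null sequence $(\chi_n)$ in $E'$; $E$ is called Gelfand–Phillips if every limited subset of $E$ has compact closure. A Tychonoff space $X$ is called an $F$-space if for every continuous $g:X\to\mathbb R$ and $A=\{x\in X: g(x)\neq 0\}$, every bounded continuous function $A\to\mathbb R$ has a continuous extension $X\to\mathbb R$. For compact Hausdorff $K$, let $C(K)$ be the Banach space of continuous functions $K\to\mathbb F$ with the supremum norm. (1) For every infinite compact Hausdorff $F$-space $K$, the Banach space $C(K)$ is not Gelfand–Phillips. (2) For every discrete space $\Gamma$, the Stone–Čech compactification $\beta\Gamma$ is a compact $F$-space. Consequently, if $\Gamma$ is infinite, $C(\beta\Gamma)$ is not Gelfand–Phillips; in particular (Phillips), the Banach space $\ell_\infty=\ell_\infty(\mathbb N,\mathbb F)$ is not Gelfand–Phillips. -/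

import Mathlib

open Filter Topology Bornology
open scoped BoundedContinuousFunction

section GelfandPhillips

variable (𝕜 : Type*) [RCLike 𝕜] {E : Type*} [NormedAddCommGroup E] [NormedSpace 𝕜 E]

/-- The quantity `‖χ‖_B = sup {|χ(x)| : x ∈ B}` for a functional `χ` in the dual of `E` and a
bounded subset `B` of `E` (it is `0` for empty `B`). -/
noncomputable def supNormOn (B : Set E) (χ : WeakDual 𝕜 E) : ℝ :=
  ⨆ x : B, ‖χ (x : E)‖

/-- A subset `B` of a Banach space is limited if it is bounded and every weak-star null sequence
of functionals converges to zero uniformly on `B`. -/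
def IsLimitedSet (B : Set E) : Prop :=
  IsBounded B ∧ ∀ χ : ℕ → WeakDual 𝕜 E, Tendsto χ atTop (𝓝 0) →
    Tendsto (fun n => supNormOn 𝕜 B (χ n)) atTop (𝓝 0)

/-- A Banach space is Gelfand--Phillips if each limited subset has compact closure. -/
def IsGelfandPhillips (𝕜 : Type*) [RCLike 𝕜] (E : Type*) [NormedAddCommGroup E]
    [NormedSpace 𝕜 E] : Prop :=
  ∀ B : Set E, IsLimitedSet 𝕜 B → IsCompact (closure B)

end GelfandPhillips

section FSpace

variable {X : Type*} [TopologicalSpace X]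

/-- A functionally open (cozero) set: the set of points where some continuous real-valued
function does not vanish. -/
def IsFunctionallyOpen (A : Set X) : Prop :=
  ∃ g : C(X, ℝ), A = {x | g x ≠ 0}

/-- `A` is `C^*`-embedded in `X`: each bounded continuous real-valued function on `A` has a
continuous extension to `X`. -/
def IsCStarEmbedded (A : Set X) : Prop :=
  ∀ f : A →ᵇ ℝ, ∃ F : C(X, ℝ), ∀ x : A, F x = f x

/-- A (Tychonoff) space is an `F`-space if every functionally open subset is `C^*`-embedded. -/
def IsFSpace (X : Type*) [TopologicalSpace X] [T35Space X] : Prop :=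
  ∀ A : Set X, IsFunctionallyOpen A → IsCStarEmbedded A

end FSpace

/-! ### Cozero sets and gluing in `F`-spaces. -/

section CozeroSets

variable {X : Type*} [TopologicalSpace X]

/-! In an infinite compact `F`-space, disjoint functions of norm one are at mutual distance at least
1, so their range is not relatively compact; the point is that it is limited. If not, some weak-star
null sequence satisfies `2δ ≤ ‖χ j (f j)‖` after reindexing. Split ℕ into infinitely many infinite
blocks and glue each block to a single `H i` (`IsFSpace.exists_glue`). Since `χ j (H i) → 0` along
block `i`, some `k i` in it has `δ ≤ ‖χ (k i) (H i - f (k i))‖`: at least `δ` of the variation of `χ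
(k i)` lies off all the retained `f (k j)`. Discarding that region lowers the bound on the
variations by `δ`; Banach–Steinhaus makes the initial bound finite, so finitely many rounds give a
contradiction. For `ℓ_∞`, the property would pass to the isometric copy of `C(βℕ)`. -/

lemma IsFunctionallyOpen.isOpen {A : Set X} (hA : IsFunctionallyOpen A) : IsOpen A := by
  obtain ⟨g, rfl⟩ := hA
  exact isOpen_ne_fun g.continuous continuous_const

lemma isFunctionallyOpen_ne_zero (g : C(X, ℝ)) : IsFunctionallyOpen {x | g x ≠ 0} :=
  ⟨g, rfl⟩

lemma IsFunctionallyOpen.union {A B : Set X} (hA : IsFunctionallyOpen A)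
    (hB : IsFunctionallyOpen B) : IsFunctionallyOpen (A ∪ B) := by
  obtain ⟨g, rfl⟩ := hA
  obtain ⟨h, rfl⟩ := hB
  refine ⟨g * g + h * h, ?_⟩
  ext x
  simp only [Set.mem_union, Set.mem_ofPred_eq, ContinuousMap.add_apply, ContinuousMap.mul_apply,
    ne_eq, mul_self_add_mul_self_eq_zero]
  tauto

lemma IsFunctionallyOpen.iUnion {U : ℕ → Set X} (hU : ∀ n, IsFunctionallyOpen (U n)) :
    IsFunctionallyOpen (⋃ n, U n) := by
  choose g hg using hU
  have hnn : ∀ n x, 0 ≤ (1 / 2 : ℝ) ^ n * min |g n x| 1 := fun n x => by positivity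
  have hle : ∀ n x, (1 / 2 : ℝ) ^ n * min |g n x| 1 ≤ (1 / 2 : ℝ) ^ n := fun n x =>
    mul_le_of_le_one_right (by positivity) (min_le_right _ _)
  have hs : ∀ x, Summable fun n => (1 / 2 : ℝ) ^ n * min |g n x| 1 := fun x =>
    Summable.of_nonneg_of_le (hnn · x) (hle · x) summable_geometric_two
  refine ⟨⟨fun x => ∑' n, (1 / 2 : ℝ) ^ n * min |g n x| 1, ?_⟩, ?_⟩
  · refine continuous_tsum (fun n => by fun_prop) summable_geometric_two fun n x => ?_
    rw [Real.norm_of_nonneg (hnn n x)]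
    exact hle n x
  · ext x
    simp only [hg, Set.mem_iUnion, Set.mem_ofPred_eq, ContinuousMap.coe_mk]
    constructor
    · rintro ⟨n, hn⟩
      refine ((hs x).tsum_pos (hnn · x) n ?_).ne'
      have := abs_pos.2 hn
      positivity
    · intro h
      by_contra! hc
      exact h (by simp [hc])

/-- In an `F`-space, part of a disjoint sequence of functions can be glued to one continuous
function which vanishes where the other functions of the sequence live, and on a given cozero set
disjoint from all of them. -/
lemma IsFSpace.exists_glue [T35Space X] (hX : IsFSpace X) {f : ℕ → C(X, ℝ)}
    (h01 : ∀ i x, f i x ∈ Set.Icc (0 : ℝ) 1)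
    (hdisj : ∀ i j, i ≠ j → ∀ x, f i x ≠ 0 → f j x = 0)
    {Q : Set X} (hQ : IsFunctionallyOpen Q) (hfQ : ∀ i, ∀ x ∈ Q, f i x = 0) (A : Set ℕ) :
    ∃ h : C(X, ℝ), (∀ x, h x ∈ Set.Icc (0 : ℝ) 1) ∧
      (∀ i ∈ A, ∀ x, f i x ≠ 0 → h x = f i x) ∧
      (∀ i ∉ A, ∀ x, f i x ≠ 0 → h x = 0) ∧ ∀ x ∈ Q, h x = 0 := by
  classical
  set F : X → ℝ := fun x => ∑' i, if i ∈ A then f i x else 0 with hF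
  have hFi : ∀ i x, f i x ≠ 0 → F x = if i ∈ A then f i x else 0 := fun i x hx =>
    tsum_eq_single i fun j hj => by simp [hdisj i j hj.symm x hx]
  have hFQ : ∀ x ∈ Q, F x = 0 := fun x hx => by simp [hF, hfQ _ x hx]
  -- `F` may be discontinuous only off `O`; including `Q` forces the extension to vanish there.
  set O : Set X := Q ∪ ⋃ i, {x | f i x ≠ 0}
  have hOo : IsFunctionallyOpen O :=
    hQ.union (IsFunctionallyOpen.iUnion fun i => isFunctionallyOpen_ne_zero (f i))
  have hF01 : ∀ x ∈ O, F x ∈ Set.Icc (0 : ℝ) 1 := by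
    rintro x (hx | hx)
    · simp [hFQ x hx]
    · obtain ⟨i, hi⟩ := Set.mem_iUnion.1 hx
      rw [hFi i x hi]
      split_ifs
      exacts [h01 i x, by simp]
  have hcont : ContinuousOn F O := by
    rintro x (hx | hx)
    · refine (continuousAt_const.congr (f := fun _ => (0 : ℝ)) ?_).continuousWithinAt
      filter_upwards [hQ.isOpen.mem_nhds hx] with y hy using (hFQ y hy).symm
    · obtain ⟨i, hi⟩ := Set.mem_iUnion.1 hx
      have hc : Continuous fun y => if i ∈ A then f i y else 0 := by
        split_ifs <;> fun_prop
      refine (hc.continuousAt.congr ?_).continuousWithinAt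
      filter_upwards [(isFunctionallyOpen_ne_zero (f i)).isOpen.mem_nhds hi] with y hy
        using (hFi i y hy).symm
  obtain ⟨G, hG⟩ := hX O hOo (BoundedContinuousFunction.ofNormedAddCommGroup
    (fun x : O => F x) (continuousOn_iff_continuous_domRestrict.1 hcont) 1 fun x => by
      have := hF01 x x.2
      rw [Real.norm_of_nonneg this.1]
      exact this.2)
  -- Clamping the extension to `[0, 1]` does not change it on `O`.
  have hGF : ∀ x ∈ O, max 0 (min (G x) 1) = F x := fun x hx => by
    have h1 : G x = F x := hG ⟨x, hx⟩
    have h2 := hF01 x hx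
    rw [h1, min_eq_left h2.2, max_eq_right h2.1]
  have hmem : ∀ i x, f i x ≠ 0 → x ∈ O := fun i x hx => Or.inr (Set.mem_iUnion.2 ⟨i, hx⟩)
  refine ⟨⟨fun x => max 0 (min (G x) 1), by fun_prop⟩, fun x => ?_, fun i hi x hx => ?_,
    fun i hi x hx => ?_, fun x hx => ?_⟩
  · exact ⟨le_max_left _ _, max_le zero_le_one (min_le_right _ _)⟩
  · exact (hGF x (hmem i x hx)).trans (by rw [hFi i x hx, if_pos hi])
  · exact (hGF x (hmem i x hx)).trans (by rw [hFi i x hx, if_neg hi])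
  · exact (hGF x (Or.inl hx)).trans (hFQ x hx)

end CozeroSets

section DisjointSequence

/-- An infinite compact Hausdorff space carries a sequence of norm-one functions with pairwise
disjoint cozero sets. -/
lemma exists_disjoint_seq (K : Type*) [TopologicalSpace K] [CompactSpace K] [T2Space K]
    [Infinite K] : ∃ f : ℕ → C(K, ℝ), (∀ i x, f i x ∈ Set.Icc (0 : ℝ) 1) ∧
      (∀ i j, i ≠ j → ∀ x, f i x ≠ 0 → f j x = 0) ∧ ∀ i, ∃ x, f i x = 1 := by
  obtain ⟨U, hinf, hopen, hdisj⟩ := exists_seq_infinite_isOpen_pairwise_disjoint K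
  choose p hp using fun n => (hinf n).nonempty
  choose f hf0 hf1 hf using fun n => exists_continuous_zero_one_of_isClosed
    (hopen n).isClosed_compl (isClosed_singleton (x := p n)) (by simpa using hp n)
  refine ⟨f, hf, fun i j hij x hx => hf0 j ?_, fun i => ⟨p i, hf1 i rfl⟩⟩
  have hxi : x ∈ U i := by
    by_contra h
    exact hx (hf0 i h)
  exact Set.disjoint_left.1 (hdisj hij) hxi

end DisjointSequence

/-! ### Disjoint sequences are limited. -/

section GlidingHump

variable {𝕜 : Type*} [RCLike 𝕜] {K : Type*} [TopologicalSpace K]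

/-- A real-valued continuous function regarded as a function with values in `𝕜`. -/
def ContinuousMap.toRCLike (𝕜 : Type*) [RCLike 𝕜] (f : C(K, ℝ)) : C(K, 𝕜) :=
  ⟨fun x => (f x : 𝕜), RCLike.continuous_ofReal.comp f.continuous⟩

@[simp]
lemma ContinuousMap.toRCLike_apply (f : C(K, ℝ)) (x : K) : f.toRCLike 𝕜 x = (f x : 𝕜) := rfl

lemma ContinuousMap.norm_toRCLike_apply_le {f : C(K, ℝ)} {x : K}
    (h : f x ∈ Set.Icc (0 : ℝ) 1) : ‖f.toRCLike 𝕜 x‖ ≤ 1 := by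
  rw [toRCLike_apply, RCLike.norm_ofReal, abs_of_nonneg h.1]
  exact h.2

/-- Additivity of the variation of a functional over disjointly supported functions. -/
lemma norm_apply_add_norm_apply_le [CompactSpace K] (χ : C(K, 𝕜) →L[𝕜] 𝕜) {Q : Set K} {c : ℝ}
    (hc : ∀ h : C(K, 𝕜), (∀ x, ‖h x‖ ≤ 1) → (∀ x ∈ Q, h x = 0) → ‖χ h‖ ≤ c)
    {g h : C(K, 𝕜)} (hg1 : ∀ x, ‖g x‖ ≤ 1) (hh1 : ∀ x, ‖h x‖ ≤ 1)
    (hgQ : ∀ x ∈ Q, g x = 0) (hhQ : ∀ x ∈ Q, h x = 0) (hgh : ∀ x, g x = 0 ∨ h x = 0) :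
    ‖χ g‖ + ‖χ h‖ ≤ c := by
  -- Unimodular `a`, `b` align the phases; disjointness keeps `a • g + b • h` in the unit ball.
  obtain ⟨a, ha, hag⟩ := RCLike.exists_norm_eq_mul_self (χ g)
  obtain ⟨b, hb, hbh⟩ := RCLike.exists_norm_eq_mul_self (χ h)
  have key := hc (a • g + b • h) (fun x => ?_) (fun x hx => by simp [hgQ x hx, hhQ x hx])
  · rwa [map_add, map_smul, map_smul, smul_eq_mul, smul_eq_mul, ← hag, ← hbh, ← RCLike.ofReal_add,
      RCLike.norm_of_nonneg (by positivity)] at key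
  · rcases hgh x with hx | hx
    · simpa [hx, hb] using hh1 x
    · simpa [hx, ha] using hg1 x

/-- The gliding hump: in an `F`-space, a weak-star null sequence of functionals cannot be bounded
away from zero along a disjoint sequence of functions in the unit ball. The induction is on the
size of the functionals on the functions vanishing on `Q`. -/
theorem IsFSpace.false_of_disjoint_of_le [CompactSpace K] [T2Space K] (hK : IsFSpace K) {δ : ℝ}
    (hδ : 0 < δ) (n : ℕ) : ∀ {f : ℕ → C(K, ℝ)} (_ : ∀ i x, f i x ∈ Set.Icc (0 : ℝ) 1)
    (_ : ∀ i j, i ≠ j → ∀ x, f i x ≠ 0 → f j x = 0)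
    {Q : Set K} (_ : IsFunctionallyOpen Q) (_ : ∀ i, ∀ x ∈ Q, f i x = 0)
    {χ : ℕ → C(K, 𝕜) →L[𝕜] 𝕜} (_ : ∀ h, Tendsto (fun j => χ j h) atTop (𝓝 0))
    (_ : ∀ j, 2 * δ ≤ ‖χ j ((f j).toRCLike 𝕜)‖)
    (_ : ∀ j (h : C(K, 𝕜)), (∀ x, ‖h x‖ ≤ 1) → (∀ x ∈ Q, h x = 0) → ‖χ j h‖ ≤ n * δ), False := by
  induction n with
  | zero =>
    intro f h01 hdisj Q hQ hfQ χ hχ hbig hbd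
    have h1 := hbd 0 ((f 0).toRCLike 𝕜) (fun x => ContinuousMap.norm_toRCLike_apply_le (h01 0 x))
      (fun x hx => by simp [hfQ 0 x hx])
    have h2 := hbig 0
    simp only [Nat.cast_zero, zero_mul] at h1
    linarith
  | succ n ih =>
    intro f h01 hdisj Q hQ hfQ χ hχ hbig hbd
    -- The blocks are the rows `Nat.pair i ·` of the pairing ℕ × ℕ ≃ ℕ.
    choose H hH01 hHf hH0 hHQ using fun i : ℕ =>
      hK.exists_glue h01 hdisj hQ hfQ (Set.range (Nat.pair i))
    have hpair : ∀ i, Function.Injective (Nat.pair i) := fun i a b hab =>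
      (Nat.pair_eq_pair.1 hab).2
    have hex : ∀ i, ∃ m, δ ≤ ‖χ (Nat.pair i m) ((H i - f (Nat.pair i m)).toRCLike 𝕜)‖ := by
      intro i
      by_contra! hlt
      have ht : Tendsto (fun m => ‖χ (Nat.pair i m) ((H i).toRCLike 𝕜)‖) atTop (𝓝 0) := by
        simpa using ((hχ ((H i).toRCLike 𝕜)).comp (hpair i).nat_tendsto_atTop).norm
      obtain ⟨m, hm⟩ := (ht.eventually (gt_mem_nhds hδ)).exists
      have h1 := hbig (Nat.pair i m)
      have h2 := hlt m
      have h3 : (f (Nat.pair i m)).toRCLike 𝕜 =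
          (H i).toRCLike 𝕜 - (H i - f (Nat.pair i m)).toRCLike 𝕜 := by
        ext x
        simp
      rw [h3, map_sub] at h1
      have := norm_sub_le (χ (Nat.pair i m) ((H i).toRCLike 𝕜))
        (χ (Nat.pair i m) ((H i - f (Nat.pair i m)).toRCLike 𝕜))
      linarith
    choose m hm using hex
    set k : ℕ → ℕ := fun i => Nat.pair i (m i) with hk
    have hkinj : Function.Injective k := fun a b hab => (Nat.pair_eq_pair.1 hab).1
    set g : ℕ → C(K, ℝ) := fun i => H i - f (k i) with hg
    have hHk : ∀ i x, f (k i) x ≠ 0 → H i x = f (k i) x := fun i x hx =>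
      hHf i _ ⟨m i, rfl⟩ x hx
    have hg01 : ∀ i x, g i x ∈ Set.Icc (0 : ℝ) 1 := by
      intro i x
      by_cases hx : f (k i) x = 0
      · simpa [hg, hx] using hH01 i x
      · simp [hg, hHk i x hx]
    have hgQ : ∀ i, ∀ x ∈ Q, g i x = 0 := fun i x hx => by simp [hg, hHQ i x hx, hfQ _ x hx]
    have hfg : ∀ i j x, f (k j) x ≠ 0 → g i x = 0 := by
      intro i j x hx
      rcases eq_or_ne j i with rfl | hji
      · simp [hg, hHk j x hx]
      · have h1 : k j ∉ Set.range (Nat.pair i) := by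
          rintro ⟨a, ha⟩
          exact hji (Nat.pair_eq_pair.1 ha).1.symm
        simp [hg, hH0 i _ h1 x hx, hdisj _ _ (hkinj.ne hji) x hx]
    -- The cozero sets of all `g i` join `Q`. Functions vanishing there are disjoint from `g j`, on
    -- which `χ (k j)` already spends `δ`, so the bound drops from `(n + 1) * δ` to `n * δ`.
    refine ih (f := fun i => f (k i)) (fun i => h01 _)
      (fun i j hij => hdisj _ _ (hkinj.ne hij))
      (hQ.union (IsFunctionallyOpen.iUnion fun i => isFunctionallyOpen_ne_zero (g i)))
      (fun j x hx => ?_) (χ := fun i => χ (k i))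
      (fun h => (hχ h).comp hkinj.nat_tendsto_atTop) (fun i => hbig _) (fun j h hh1 hhQ => ?_)
    · rcases hx with hx | hx
      · exact hfQ _ x hx
      · obtain ⟨i, hi⟩ := Set.mem_iUnion.1 hx
        by_contra hne
        exact hi (hfg i j x hne)
    · have := norm_apply_add_norm_apply_le (χ (k j)) (hbd (k j))
        (fun x => ContinuousMap.norm_toRCLike_apply_le (hg01 j x)) hh1
        (fun x hx => by simp [hgQ j x hx]) (fun x hx => hhQ x (Or.inl hx)) (fun x => by
          by_cases hx : g j x = 0
          · exact Or.inl (by simp [hx])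
          · exact Or.inr (hhQ x (Or.inr (Set.mem_iUnion.2 ⟨j, hx⟩))))
      have h2 := hm j
      push_cast at this
      linarith

/-- A disjoint sequence in the unit ball of `C(K, 𝕜)` is limited when `K` is an `F`-space. -/
theorem IsFSpace.isLimitedSet_range [CompactSpace K] [T2Space K] (hK : IsFSpace K)
    {f : ℕ → C(K, ℝ)} (h01 : ∀ i x, f i x ∈ Set.Icc (0 : ℝ) 1)
    (hdisj : ∀ i j, i ≠ j → ∀ x, f i x ≠ 0 → f j x = 0) :
    IsLimitedSet 𝕜 (Set.range fun i => (f i).toRCLike 𝕜) := by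
  refine ⟨(Metric.isBounded_closedBall (x := (0 : C(K, 𝕜))) (r := 1)).subset ?_, fun χ hχ => ?_⟩
  · rintro _ ⟨i, rfl⟩
    rw [mem_closedBall_zero_iff, ContinuousMap.norm_le _ zero_le_one]
    exact fun x => ContinuousMap.norm_toRCLike_apply_le (h01 i x)
  have hpt : ∀ h : C(K, 𝕜), Tendsto (fun n => χ n h) atTop (𝓝 0) := fun h =>
    ((WeakDual.eval_continuous h).tendsto 0).comp hχ
  have hnn : ∀ n, 0 ≤ supNormOn 𝕜 (Set.range fun i => (f i).toRCLike 𝕜) (χ n) := fun n =>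
    Real.iSup_nonneg fun _ => norm_nonneg _
  by_contra hnot
  obtain ⟨δ, hδ, hfreq⟩ : ∃ δ > 0, ∃ᶠ n in atTop,
      2 * δ < supNormOn 𝕜 (Set.range fun i => (f i).toRCLike 𝕜) (χ n) := by
    by_contra! hc
    refine hnot (Metric.tendsto_nhds.2 fun ε hε => ?_)
    have := hc (ε / 4) (by positivity)
    filter_upwards [this] with n hn
    rw [dist_zero_right, Real.norm_of_nonneg (hnn n)]
    linarith
  -- Both indices can be taken large: each fixed `f i` is eventually small under `χ n`.
  have hfreq' : ∃ᶠ p : ℕ × ℕ in atTop, 2 * δ ≤ ‖χ p.1 ((f p.2).toRCLike 𝕜)‖ := by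
    rw [frequently_atTop]
    rintro ⟨a, b⟩
    have hsmall : ∀ᶠ n in atTop, ∀ i ∈ Finset.range b, ‖χ n ((f i).toRCLike 𝕜)‖ < 2 * δ := by
      rw [eventually_all_finset]
      intro i _
      have : Tendsto (fun n => ‖χ n ((f i).toRCLike 𝕜)‖) atTop (𝓝 0) := by
        simpa using (hpt ((f i).toRCLike 𝕜)).norm
      exact this.eventually (gt_mem_nhds (by positivity))
    obtain ⟨n, hn, hns, hna⟩ := (hfreq.and_eventually
      (hsmall.and (eventually_ge_atTop a))).exists
    obtain ⟨i, hi⟩ : ∃ i, 2 * δ < ‖χ n ((f i).toRCLike 𝕜)‖ := by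
      by_contra! hc
      refine hn.not_ge (Real.iSup_le ?_ (by positivity))
      rintro ⟨_, i, rfl⟩
      exact hc i
    refine ⟨(n, i), ⟨hna, ?_⟩, hi.le⟩
    by_contra! hib
    exact (hns i (Finset.mem_range.2 hib)).not_gt hi
  obtain ⟨u, hu, hbig⟩ := exists_seq_forall_of_frequently hfreq'
  rw [← prod_atTop_atTop_eq] at hu
  obtain ⟨φ, hφ, hφ2⟩ := strictMono_subseq_of_tendsto_atTop (tendsto_snd.comp hu)
  have hu1 : Tendsto (fun j => (u (φ j)).1) atTop atTop :=
    (tendsto_fst.comp hu).comp hφ.tendsto_atTop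
  obtain ⟨C, hC⟩ := banach_steinhaus (g := fun n => WeakDual.toStrongDual (χ n)) fun h => by
    obtain ⟨C, hC⟩ := (hpt h).norm.bddAbove_range
    exact ⟨C, fun n => hC ⟨n, rfl⟩⟩
  obtain ⟨N, hN⟩ := exists_nat_ge (C / δ)
  rw [div_le_iff₀ hδ] at hN
  refine hK.false_of_disjoint_of_le hδ N (f := fun j => f (u (φ j)).2) (fun i => h01 _)
    (fun i j hij => hdisj _ _ (hφ2.injective.ne hij)) (Q := ∅) ⟨0, by simp⟩ (by simp)
    (χ := fun j => WeakDual.toStrongDual (χ (u (φ j)).1)) (fun h => (hpt h).comp hu1)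
    (fun j => hbig (φ j)) (fun j h hh _ => ?_)
  have h1 : ‖h‖ ≤ 1 := (ContinuousMap.norm_le _ zero_le_one).2 hh
  calc _ ≤ ‖WeakDual.toStrongDual (χ (u (φ j)).1)‖ * ‖h‖ := ContinuousLinearMap.le_opNorm _ _
    _ ≤ ‖WeakDual.toStrongDual (χ (u (φ j)).1)‖ := mul_le_of_le_one_right (norm_nonneg _) h1
    _ ≤ N * δ := (hC _).trans hN

/-- The space of continuous functions on an infinite compact `F`-space is not
Gelfand--Phillips. -/
theorem IsFSpace.not_isGelfandPhillips [CompactSpace K] [T2Space K] [Infinite K]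
    (hK : IsFSpace K) : ¬ IsGelfandPhillips 𝕜 C(K, 𝕜) := by
  intro hGP
  obtain ⟨f, h01, hdisj, h1⟩ := exists_disjoint_seq K
  have hcpt := hGP _ (hK.isLimitedSet_range (𝕜 := 𝕜) h01 hdisj)
  obtain ⟨a, -, φ, hφ, ha⟩ := hcpt.tendsto_subseq
    (x := fun i => (f i).toRCLike 𝕜) fun i => subset_closure ⟨i, rfl⟩
  obtain ⟨N, hN⟩ := Metric.cauchySeq_iff'.1 ha.cauchySeq 1 one_pos
  have hlt := hN (N + 1) N.le_succ
  obtain ⟨x, hx⟩ := h1 (φ (N + 1))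
  have h0 : f (φ N) x = 0 := hdisj _ _ (hφ.injective.ne N.succ_ne_self) x (by simp [hx])
  have := (ContinuousMap.dist_apply_le_dist x).trans_lt hlt
  simp [hx, h0] at this

end GlidingHump

/-! ### The space `βΓ` and restriction to `Γ`. -/

section StoneCech

/-- The Stone--Čech compactification of a discrete space is an `F`-space. -/
theorem isFSpace_stoneCech (Γ : Type*) [TopologicalSpace Γ] [DiscreteTopology Γ] :
    IsFSpace (StoneCech Γ) := by
  classical
  intro A hA f
  -- Extend `f` by zero on `Γ`; the compact ball as codomain lets `φ` extend to `βΓ`.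
  let φ : Γ → Metric.closedBall (0 : ℝ) ‖f‖ := fun γ =>
    if h : stoneCechUnit γ ∈ A then ⟨f ⟨_, h⟩, by simpa using f.norm_coe_le_norm _⟩
    else ⟨0, by simp⟩
  have hφ : Continuous φ := continuous_of_discreteTopology
  let F : C(StoneCech Γ, ℝ) :=
    ⟨fun x => (stoneCechExtend hφ x : Metric.closedBall (0 : ℝ) ‖f‖), continuous_subtype_val.comp (continuous_stoneCechExtend hφ)⟩
  -- As `A` is open, the points of `Γ` in `A` are dense in `A`, so agreement there suffices.
  have hd : Dense ((↑) ⁻¹' Set.range (stoneCechUnit : Γ → StoneCech Γ) : Set A) :=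
    denseRange_stoneCechUnit.preimage hA.isOpen.isOpenMap_subtype_val
  refine ⟨F, fun x => congrFun (Continuous.ext_on hd (F.continuous.comp continuous_subtype_val)
    f.continuous ?_) x⟩
  rintro ⟨_, hx⟩ ⟨γ, rfl⟩
  simp [F, φ, hx]

instance infinite_stoneCech (Γ : Type*) [TopologicalSpace Γ] [DiscreteTopology Γ] [Infinite Γ] :
    Infinite (StoneCech Γ) :=
  Infinite.of_injective _ injective_stoneCechUnit_of_t35Space

/-- Restriction to `α`, as an isometric embedding of `C(βα)` into the bounded functions on `α`. -/
noncomputable def stoneCechRestrict (𝕜 : Type*) [RCLike 𝕜] (α : Type*) [TopologicalSpace α] :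
    C(StoneCech α, 𝕜) →ₗᵢ[𝕜] (α →ᵇ 𝕜) where
  toFun h := (BoundedContinuousFunction.mkOfCompact h).compContinuous
    ⟨stoneCechUnit, continuous_stoneCechUnit⟩
  map_add' _ _ := rfl
  map_smul' _ _ := rfl
  norm_map' h := by
    refine le_antisymm ((BoundedContinuousFunction.norm_le (norm_nonneg _)).2 fun x =>
      h.norm_coe_le_norm _) ((ContinuousMap.norm_le _ (norm_nonneg _)).2 fun x => ?_)
    refine denseRange_stoneCechUnit.induction_on x
      (isClosed_le h.continuous.norm continuous_const) fun a => ?_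
    exact BoundedContinuousFunction.norm_coe_le_norm
      ((BoundedContinuousFunction.mkOfCompact h).compContinuous
        ⟨stoneCechUnit, continuous_stoneCechUnit⟩) a

end StoneCech

/-! ### Transfer along isometric embeddings. -/

section Isometry

variable {𝕜 : Type*} [RCLike 𝕜] {E F : Type*} [NormedAddCommGroup E] [NormedSpace 𝕜 E]
  [NormedAddCommGroup F] [NormedSpace 𝕜 F]

/-- The adjoint of `T` preserves weak-star null sequences, and `χ` has the same supremum over `T ''
B` as `χ ∘ T` over `B`. -/
lemma IsLimitedSet.image {B : Set E} (hB : IsLimitedSet 𝕜 B) (T : E →L[𝕜] F) :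
    IsLimitedSet 𝕜 (T '' B) := by
  refine ⟨T.lipschitz.isBounded_image hB.1, fun χ hχ => ?_⟩
  have h := hB.2 (fun n => StrongDual.toWeakDual ((WeakDual.toStrongDual (χ n)).comp T)) (by
    rw [tendsto_iff_forall_eval_tendsto_topDualPairing]
    intro x
    exact ((WeakDual.eval_continuous (T x)).tendsto 0).comp hχ)
  refine h.congr fun n => ?_
  simp only [supNormOn, iSup]
  congr 1
  ext r
  simp

/-- The Gelfand--Phillips property passes to complete subspaces. -/
lemma IsGelfandPhillips.of_linearIsometry [CompleteSpace E] (T : E →ₗᵢ[𝕜] F)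
    (hF : IsGelfandPhillips 𝕜 F) : IsGelfandPhillips 𝕜 E := fun B hB => by
  -- Completeness of `E` makes the range of `T` closed.
  have h := T.isometry.isClosedEmbedding.isCompact_preimage
    (hF _ (hB.image T.toContinuousLinearMap))
  refine h.of_isClosed_subset isClosed_closure (closure_minimal (fun x hx => ?_)
    (isClosed_closure.preimage T.continuous))
  exact subset_closure ⟨x, hx, rfl⟩

end Isometry


theorem mainTheorem6 (𝕜 : Type*) [RCLike 𝕜] :
    (∀ (K : Type*) [TopologicalSpace K] [CompactSpace K] [T2Space K] [Infinite K],
      IsFSpace K → ¬ IsGelfandPhillips 𝕜 C(K, 𝕜)) ∧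
    (∀ (Γ : Type*) [TopologicalSpace Γ] [DiscreteTopology Γ], IsFSpace (StoneCech Γ)) ∧
    (∀ (Γ : Type*) [TopologicalSpace Γ] [DiscreteTopology Γ] [Infinite Γ],
      ¬ IsGelfandPhillips 𝕜 C(StoneCech Γ, 𝕜)) ∧
    ¬ IsGelfandPhillips 𝕜 (lp (fun _ : ℕ => 𝕜) ⊤) := by

  refine ⟨fun K _ _ _ _ hK => hK.not_isGelfandPhillips, fun Γ _ _ => isFSpace_stoneCech Γ,
    fun Γ _ _ _ => (isFSpace_stoneCech Γ).not_isGelfandPhillips, fun h => ?_⟩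
  exact (isFSpace_stoneCech ℕ).not_isGelfandPhillips (h.of_linearIsometry
    ((lpBCFₗᵢ 𝕜 𝕜).symm.toLinearIsometry.comp (stoneCechRestrict 𝕜 ℕ)))
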